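/- For a finite connected graph $G$ write $d_G(u,v)$ for the distance between the vertices $u,v$ and $e_G(u)=\max_v d_G(u,v)$ for the eccentricity of $u$. The eccentricity matrix $\mathcal{E}(G)$ is the real symmetric matrix indexed by the vertices of $G$ with $$\mathcal{E}(G)_{uv}=\begin{cases} d_G(u,v) & \text{if } d_G(u,v)=\min\{e_G(u),e_G(v)\},\\ 0 & \text{otherwise.}\end{cases}$$ For a graph $G$ on $n$ vertices let $\xi_n(G)$ denote the least eigenvalue of $\mathcal{E}(G)$. Let $P_n$ be the path on $n$ vertices and let $G^c$ denote the complement of $G$. **Theorem.** Let $T$ be a tree on $n\ge 4$ vertices whose complement $T^c$ is connected (equivalently, $T$ is not a star). Then $$\xi_n(T^c)\le \xi_n(P_n^c),$$ with equality if and only if $T\cong P_n$. -/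

import Mathlib

/-- The eccentricity matrix of a finite graph `G`: the `(u, v)` entry is the distance `d_G(u, v)`
if it equals the smaller of the eccentricities of `u` and `v`, and `0` otherwise.
(The comparison is made in `ℕ∞`; for a connected graph all the quantities are finite.) -/
noncomputable def eccentricityMatrix {V : Type*} (G : SimpleGraph V) : Matrix V V ℝ :=
  Matrix.of fun u v =>
    if G.edist u v = min (G.eccent u) (G.eccent v) then (G.dist u v : ℝ) else 0

/-- The least eigenvalue of the eccentricity matrix of `G`. For a graph with at least one vertex
this is a genuine minimum, see `isLeast_leastEccEigenvalue`. -/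
noncomputable def leastEccEigenvalue {V : Type*} [Fintype V] [DecidableEq V]
    (G : SimpleGraph V) : ℝ :=
  sInf (spectrum ℝ (eccentricityMatrix G))

theorem eccentricityMatrix_isHermitian {V : Type*} (G : SimpleGraph V) :
    (eccentricityMatrix G).IsHermitian := by
  ext u v
  simp only [Matrix.conjTranspose_apply, eccentricityMatrix, Matrix.of_apply, star_trivial]
  rw [SimpleGraph.edist_comm, min_comm, SimpleGraph.dist_comm]

theorem isLeast_leastEccEigenvalue {V : Type*} [Fintype V] [DecidableEq V] [Nonempty V]
    (G : SimpleGraph V) :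
    IsLeast (spectrum ℝ (eccentricityMatrix G)) (leastEccEigenvalue G) := by
  have h : spectrum ℝ (eccentricityMatrix G) =
      Set.range (eccentricityMatrix_isHermitian G).eigenvalues :=
    (eccentricityMatrix_isHermitian G).spectrum_real_eq_range_eigenvalues
  have hf : (spectrum ℝ (eccentricityMatrix G)).Finite := h ▸ Set.finite_range _
  have hn : (spectrum ℝ (eccentricityMatrix G)).Nonempty := h ▸ Set.range_nonempty _
  exact ⟨hn.csInf_mem hf, fun _ hx => csInf_le hf.bddBelow hx⟩

/-! `eccentricityMatrix Tᶜ` vanishes off the edges of T and is at least 2 on them. Since T is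
bipartite, alternating signs turn the claim into one on adjacency spectral radii: only the path has
radius as small as 2 cos θ, θ = π/(n+1). For a non-path, root T at a vertex r of degree at least 3.
A positive vector z is built by hanging each branch of size k as if it were a path: the ratio of
child to parent is `sinRatio θ k`. Subadditivity of `sinRatio` gives Az ≥ 2 cos θ · z, strictly at r
(`exists_pos_two_cos_mul_le_sum`), and the Rayleigh quotient of the signed z is below -4 cos θ. For
the path with n ≥ 5 the entries on edges are at most 2, and the sine vector bounds the spectrum
below by -4 cos θ. When n = 4 the only tree that is not a star is the path. -/

/-- The ratio `sin (k θ) / sin ((k + 1) θ)` of consecutive entries of the principal eigenvector of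
a path. -/
noncomputable def sinRatio (θ : ℝ) (k : ℕ) : ℝ :=
  Real.sin (k * θ) / Real.sin ((k + 1) * θ)

/-! ### Sine ratios and their subadditivity. -/

section SinRatio

variable {n : ℕ} {θ : ℝ}

theorem sin_natCast_mul_pos (hθ : (n + 1) * θ = Real.pi) {k : ℕ} (h1 : 1 ≤ k) (h2 : k ≤ n) :
    0 < Real.sin (k * θ) := by
  have hpos : 0 < θ := by
    have : (0 : ℝ) < (n + 1) * θ := hθ ▸ Real.pi_pos
    exact (mul_pos_iff_of_pos_left (by positivity)).1 this
  have hk : (1 : ℝ) ≤ k := by exact_mod_cast h1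
  have hkn : (k : ℝ) ≤ n := by exact_mod_cast h2
  refine Real.sin_pos_of_pos_of_lt_pi (by positivity) ?_
  rw [← hθ]
  exact mul_lt_mul_of_pos_right (by linarith) hpos

theorem sin_natCast_mul_nonneg (hθ : (n + 1) * θ = Real.pi) {k : ℕ} (hk : k ≤ n + 1) :
    0 ≤ Real.sin (k * θ) := by
  rcases Nat.eq_zero_or_pos k with rfl | h0
  · simp
  · rcases hk.lt_or_eq with hk | rfl
    · exact (sin_natCast_mul_pos hθ h0 (by lia)).le
    · push_cast; rw [hθ, Real.sin_pi]

theorem sinRatio_zero (θ : ℝ) : sinRatio θ 0 = 0 := by simp [sinRatio]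

theorem sinRatio_pos (hθ : (n + 1) * θ = Real.pi) {k : ℕ} (h1 : 1 ≤ k) (h2 : k + 1 ≤ n) :
    0 < sinRatio θ k := by
  have := sin_natCast_mul_pos hθ (k := k + 1) (by lia) h2
  push_cast at this
  exact div_pos (sin_natCast_mul_pos hθ h1 (by lia)) this

theorem sinRatio_recurrence (hθ : (n + 1) * θ = Real.pi) {k : ℕ} (h2 : k + 2 ≤ n) :
    2 * Real.cos θ * sinRatio θ (k + 1) = 1 + sinRatio θ (k + 1) * sinRatio θ k := by
  have h1 := sin_natCast_mul_pos hθ (k := k + 1) (by lia) (by lia)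
  have h3 := sin_natCast_mul_pos hθ (k := k + 2) (by lia) (by lia)
  simp only [sinRatio]
  push_cast at h1 h3 ⊢
  have e3 : ((k : ℝ) + 1 + 1) * θ = (k + 2) * θ := by ring
  have key : Real.sin ((k + 2) * θ) =
      2 * Real.cos θ * Real.sin ((k + 1) * θ) - Real.sin (k * θ) := by
    have a : ((k : ℝ) + 2) * θ = (k + 1) * θ + θ := by ring
    have b : (k : ℝ) * θ = (k + 1) * θ - θ := by ring
    rw [a, b, Real.sin_add, Real.sin_sub]
    ring
  rw [e3]
  generalize Real.sin ((k + 2) * θ) = s₂ at *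
  generalize Real.sin ((k + 1) * θ) = s₁ at *
  field_simp
  linear_combination -key

/-- The eigenvector equation at the end of the path; it becomes the target value at the root. -/
theorem sinRatio_pred (hθ : (n + 1) * θ = Real.pi) (hn : 2 ≤ n) :
    sinRatio θ (n - 1) = 2 * Real.cos θ := by
  have h1 := sin_natCast_mul_pos hθ (k := 1) le_rfl (by lia)
  obtain ⟨m, rfl⟩ : ∃ m, n = m + 1 := ⟨n - 1, by lia⟩
  simp only [sinRatio, Nat.add_sub_cancel]
  push_cast at hθ h1
  have a : ((m : ℝ) + 1) * θ = Real.pi - θ := by linear_combination hθ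
  have b : (m : ℝ) * θ = Real.pi - 2 * θ := by linear_combination hθ
  rw [one_mul] at h1
  rw [a, b, Real.sin_pi_sub, Real.sin_pi_sub, Real.sin_two_mul]
  field_simp

/-- The factor sin((a+b+2)θ) vanishes exactly when a+b+1 = n: a path rooted at an inner vertex gives
equality. -/
theorem sinRatio_add_sub (hθ : (n + 1) * θ = Real.pi) {a b : ℕ} (h : a + b + 1 ≤ n) :
    sinRatio θ a + sinRatio θ b - sinRatio θ (a + b) =
      Real.sin ((a + b + 2 : ℕ) * θ) * Real.sin (a * θ) * Real.sin (b * θ) /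
        (Real.sin ((a + 1 : ℕ) * θ) * Real.sin ((b + 1 : ℕ) * θ) *
          Real.sin ((a + b + 1 : ℕ) * θ)) := by
  have ha := sin_natCast_mul_pos hθ (k := a + 1) (by lia) (by lia)
  have hb := sin_natCast_mul_pos hθ (k := b + 1) (by lia) (by lia)
  have hc := sin_natCast_mul_pos hθ (k := a + b + 1) (by lia) (by lia)
  simp only [sinRatio]
  push_cast at ha hb hc ⊢
  rw [div_add_div _ _ ha.ne' hb.ne', div_sub_div _ _ (by positivity) hc.ne',
    div_left_inj' (by positivity)]
  have e1 : ((a : ℝ) + 1) * θ = a * θ + θ := by ring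
  have e2 : ((b : ℝ) + 1) * θ = b * θ + θ := by ring
  have e3 : ((a : ℝ) + b + 1) * θ = a * θ + b * θ + θ := by ring
  have e4 : ((a : ℝ) + b + 2) * θ = a * θ + b * θ + θ + θ := by ring
  have e5 : ((a : ℝ) + b) * θ = a * θ + b * θ := by ring
  rw [e1, e2, e3, e4, e5]
  generalize (a : ℝ) * θ = x
  generalize (b : ℝ) * θ = y
  have hx := Real.sin_sq_add_cos_sq x
  have hy := Real.sin_sq_add_cos_sq y
  have ht := Real.sin_sq_add_cos_sq θ
  simp only [Real.sin_add, Real.cos_add]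
  generalize Real.sin x = sx at *
  generalize Real.cos x = cx at *
  generalize Real.sin y = sy at *
  generalize Real.cos y = cy at *
  generalize Real.sin θ = st at *
  generalize Real.cos θ = ct at *
  grind

theorem sinRatio_add_le (hθ : (n + 1) * θ = Real.pi) {a b : ℕ} (h : a + b + 1 ≤ n) :
    sinRatio θ (a + b) ≤ sinRatio θ a + sinRatio θ b := by
  rw [← sub_nonneg, sinRatio_add_sub hθ h]
  have hs : ∀ k : ℕ, k ≤ n + 1 → 0 ≤ Real.sin (k * θ) := fun k => sin_natCast_mul_nonneg hθ
  have h1 := hs (a + b + 2) (by lia)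
  have h2 := hs a (by lia)
  have h3 := hs b (by lia)
  have h4 := hs (a + 1) (by lia)
  have h5 := hs (b + 1) (by lia)
  have h6 := hs (a + b + 1) (by lia)
  positivity

theorem sinRatio_add_lt (hθ : (n + 1) * θ = Real.pi) {a b : ℕ} (ha : 1 ≤ a) (hb : 1 ≤ b)
    (h : a + b + 2 ≤ n) : sinRatio θ (a + b) < sinRatio θ a + sinRatio θ b := by
  rw [← sub_pos, sinRatio_add_sub hθ (by lia)]
  have hs : ∀ k : ℕ, 1 ≤ k → k ≤ n → 0 < Real.sin (k * θ) := fun k => sin_natCast_mul_pos hθ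
  have h1 := hs (a + b + 2) (by lia) (by lia)
  have h2 := hs a (by lia) (by lia)
  have h3 := hs b (by lia) (by lia)
  have h4 := hs (a + 1) (by lia) (by lia)
  have h5 := hs (b + 1) (by lia) (by lia)
  have h6 := hs (a + b + 1) (by lia) (by lia)
  positivity

theorem sinRatio_sum_le (hθ : (n + 1) * θ = Real.pi) {ι : Type*} (s : Finset ι) (k : ι → ℕ)
    (h : ∑ i ∈ s, k i + 1 ≤ n) : sinRatio θ (∑ i ∈ s, k i) ≤ ∑ i ∈ s, sinRatio θ (k i) := by
  classical
  induction s using Finset.induction_on with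
  | empty => simp [sinRatio_zero]
  | insert i s hi ih =>
    rw [Finset.sum_insert hi] at h ⊢
    rw [Finset.sum_insert hi]
    exact (sinRatio_add_le hθ h).trans (by gcongr; exact ih (by lia))

/-- Merging two parts is strict because a third nonempty part keeps their total below n-1. -/
theorem sinRatio_sum_lt (hθ : (n + 1) * θ = Real.pi) {ι : Type*} (s : Finset ι) (k : ι → ℕ)
    (hk : ∀ i ∈ s, 1 ≤ k i) (hs : 3 ≤ s.card) (h : ∑ i ∈ s, k i + 1 ≤ n) :
    sinRatio θ (∑ i ∈ s, k i) < ∑ i ∈ s, sinRatio θ (k i) := by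
  classical
  obtain ⟨i, hi⟩ : s.Nonempty := Finset.card_pos.1 (by lia)
  have hc : (s.erase i).card = s.card - 1 := Finset.card_erase_of_mem hi
  obtain ⟨j, hj⟩ : (s.erase i).Nonempty := Finset.card_pos.1 (by lia)
  have hc' : ((s.erase i).erase j).card = (s.erase i).card - 1 := Finset.card_erase_of_mem hj
  have hr : ((s.erase i).erase j).card • 1 ≤ ∑ l ∈ (s.erase i).erase j, k l :=
    Finset.card_nsmul_le_sum _ _ _ fun l hl =>
      hk l (Finset.mem_of_mem_erase (Finset.mem_of_mem_erase hl))
  simp only [smul_eq_mul, mul_one] at hr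
  rw [← Finset.add_sum_erase s k hi, ← Finset.add_sum_erase _ k hj] at h ⊢
  rw [← Finset.add_sum_erase s (fun i => sinRatio θ (k i)) hi,
    ← Finset.add_sum_erase _ (fun i => sinRatio θ (k i)) hj]
  have h1 := sinRatio_add_le hθ (a := k i + k j) (b := ∑ l ∈ (s.erase i).erase j, k l) (by lia)
  have h2 := sinRatio_add_lt hθ (hk i hi) (hk j (Finset.mem_of_mem_erase hj)) (by lia)
  have h3 := sinRatio_sum_le hθ ((s.erase i).erase j) k (by lia)
  rw [← add_assoc (k i)]
  linarith

end SinRatio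

/-! ### Rooted trees, branches and the test vector. -/

namespace SimpleGraph

variable {V : Type*} {T : SimpleGraph V}

theorem Connected.exists_adj_dist_eq_add_one (hT : T.Connected) {r u : V} (h : u ≠ r) :
    ∃ p, T.Adj u p ∧ T.dist r u = T.dist r p + 1 := by
  obtain ⟨q, hq⟩ := hT.exists_walk_length_eq_dist u r
  cases q with
  | nil => exact absurd rfl h
  | @cons _ p _ hp q =>
    refine ⟨p, hp, ?_⟩
    have h1 := dist_le q
    have h2 := hp.diff_dist_adj (u := r)
    rw [Walk.length_cons] at hq
    rw [dist_comm] at hq h1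
    lia

theorem IsTree.eq_of_adj_of_dist_eq_add_one (hT : T.IsTree) {r u w w' : V} (h : T.Adj u w)
    (h' : T.Adj u w') (hd : T.dist r u = T.dist r w + 1) (hd' : T.dist r u = T.dist r w' + 1) :
    w = w' := by
  obtain ⟨p, hp⟩ := hT.connected.exists_walk_length_eq_dist r w
  obtain ⟨p', hp'⟩ := hT.connected.exists_walk_length_eq_dist r w'
  have h1 : (p.concat h.symm).IsPath := Walk.isPath_of_length_eq_dist _ (by simp [hp, hd])
  have h2 : (p'.concat h'.symm).IsPath := Walk.isPath_of_length_eq_dist _ (by simp [hp', hd'])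
  have := (hT.existsUnique_path r u).unique h1 h2
  simpa using congrArg Walk.penultimate this

theorem exists_eq_mul_parent (r : V) (par : V → V)
    (hpar : ∀ u, u ≠ r → T.dist r u = T.dist r (par u) + 1) (f : V → ℝ) :
    ∃ z : V → ℝ, z r = 1 ∧ ∀ u, u ≠ r → z u = f u * z (par u) := by
  -- The recursion unrolls m steps towards the root; it is read at m = `T.dist r u`.
  let Z : ℕ → V → ℝ := fun m => Nat.rec (fun _ => 1) (fun _ g u => f u * g (par u)) m
  refine ⟨fun u => Z (T.dist r u) u, by simp [Z], fun u hu => ?_⟩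
  simp only
  rw [hpar u hu]

variable [Fintype V]

open Classical in
/-- For an edge `pu` of a tree, the vertices separated from `p` by that edge. -/
noncomputable def branch (T : SimpleGraph V) (p u : V) : Finset V :=
  {z | T.dist p z = T.dist u z + 1}

theorem mem_branch {p u z : V} : z ∈ T.branch p u ↔ T.dist p z = T.dist u z + 1 := by
  simp [branch]

theorem Adj.mem_branch {p u : V} (h : T.Adj p u) : u ∈ T.branch p u := by
  simp [SimpleGraph.mem_branch, h]

theorem Adj.one_le_card_branch {p u : V} (h : T.Adj p u) : 1 ≤ (T.branch p u).card :=
  Finset.card_pos.2 ⟨u, h.mem_branch⟩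

theorem IsTree.card_branch_add_card_branch (hT : T.IsTree) {p u : V} (h : T.Adj p u) :
    (T.branch p u).card + (T.branch u p).card = Fintype.card V := by
  classical
  rw [← Finset.card_union_of_disjoint, ← Finset.card_univ]
  · congr 1
    ext z
    have := hT.dist_eq_dist_add_one_of_adj z h
    simpa [SimpleGraph.mem_branch, dist_comm (v := z)] using this
  · rw [Finset.disjoint_left]
    intro z h1 h2
    rw [SimpleGraph.mem_branch] at h1 h2
    lia

open Classical in
theorem IsTree.sum_card_branch (hT : T.IsTree) (u : V) :
    ∑ w with T.Adj u w, (T.branch u w).card + 1 = Fintype.card V := by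
  rw [← Finset.card_biUnion]
  · have : (Finset.univ.filter (T.Adj u)).biUnion (T.branch u) = Finset.univ.erase u := by
      ext z
      simp only [Finset.mem_biUnion, Finset.mem_filter, Finset.mem_univ, true_and,
        SimpleGraph.mem_branch, Finset.mem_erase, and_true]
      constructor
      · rintro ⟨w, -, h⟩ rfl
        simp at h
      · intro hz
        obtain ⟨w, hw, h⟩ := hT.connected.exists_adj_dist_eq_add_one (Ne.symm hz)
        exact ⟨w, hw, by rwa [dist_comm, dist_comm (u := w)]⟩
    rw [this, Finset.card_erase_of_mem (Finset.mem_univ u), Finset.card_univ]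
    have : 0 < Fintype.card V := Fintype.card_pos_iff.2 ⟨u⟩
    lia
  · intro w hw w' hw' hne
    simp only [Finset.coe_filter, Finset.mem_univ, true_and, Set.mem_ofPred_eq] at hw hw'
    refine Finset.disjoint_left.2 fun z h1 h2 => hne ?_
    rw [SimpleGraph.mem_branch] at h1 h2
    refine hT.eq_of_adj_of_dist_eq_add_one (r := z) hw hw' ?_ ?_
    · rwa [dist_comm, dist_comm (u := z)]
    · rwa [dist_comm, dist_comm (u := z)]

open Classical in
theorem IsTree.sum_card_branch_erase (hT : T.IsTree) {p u : V} (h : T.Adj p u) :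
    ∑ w ∈ (Finset.univ.filter (T.Adj u)).erase p, (T.branch u w).card + 1 =
      (T.branch p u).card := by
  have h1 := hT.sum_card_branch u
  have h2 := hT.card_branch_add_card_branch h
  rw [← Finset.add_sum_erase _ _ (show p ∈ Finset.univ.filter (T.Adj u) by simp [h.symm])] at h1
  lia

-- At u ≠ r with branch size k+1 the child branches have total size k, so subadditivity and
-- `sinRatio_recurrence` give the bound; at r the branch sizes sum to n-1.
open Classical in
theorem IsTree.exists_pos_two_cos_mul_le_sum (hT : T.IsTree) {θ : ℝ}
    (hθ : ((Fintype.card V : ℝ) + 1) * θ = Real.pi) {r : V}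
    (hr : 3 ≤ (Finset.univ.filter (T.Adj r)).card) :
    ∃ z : V → ℝ, (∀ u, 0 < z u) ∧ (∀ u, 2 * Real.cos θ * z u ≤ ∑ w with T.Adj u w, z w) ∧
      2 * Real.cos θ * z r < ∑ w with T.Adj r w, z w := by
  choose! par hadj hdist using
    fun u (hu : u ≠ r) => hT.connected.exists_adj_dist_eq_add_one hu
  obtain ⟨z, hzr, hz⟩ := exists_eq_mul_parent r par hdist
    fun u => sinRatio θ (T.branch (par u) u).card
  have hcard : ∀ {p u : V}, T.Adj p u → (T.branch p u).card + 1 ≤ Fintype.card V := fun h => by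
    have := hT.card_branch_add_card_branch h
    have := h.symm.one_le_card_branch
    lia
  have hpos : ∀ u, 0 < z u := by
    suffices ∀ m u, T.dist r u = m → 0 < z u from fun u => this _ u rfl
    intro m
    induction m with
    | zero =>
      intro u hu
      rw [hT.connected.dist_eq_zero_iff] at hu
      simp [← hu, hzr]
    | succ m ih =>
      intro u hu
      have hur : u ≠ r := by rintro rfl; simp at hu
      rw [hz u hur]
      exact mul_pos (sinRatio_pos hθ (hadj u hur).symm.one_le_card_branch
        (hcard (hadj u hur).symm)) (ih _ (by have := hdist u hur; lia))
  have hchild : ∀ u w, T.Adj u w → T.dist r w = T.dist r u + 1 →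
      z w = sinRatio θ (T.branch u w).card * z u := by
    intro u w h hd
    have hwr : w ≠ r := by rintro rfl; simp at hd
    have hpw : par w = u :=
      hT.eq_of_adj_of_dist_eq_add_one (hadj w hwr) h.symm (hdist w hwr) hd
    rw [hz w hwr, hpw]
  have hroot : 2 * Real.cos θ * z r < ∑ w with T.Adj r w, z w := by
    have h1 : ∑ w with T.Adj r w, z w =
        ∑ w with T.Adj r w, sinRatio θ (T.branch r w).card := by
      refine Finset.sum_congr rfl fun w hw => ?_
      simp only [Finset.mem_filter, Finset.mem_univ, true_and] at hw
      rw [hchild r w hw (by simp [hw]), hzr, mul_one]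
    have hs := hT.sum_card_branch r
    have h2 := sinRatio_sum_lt hθ (Finset.univ.filter (T.Adj r)) (fun w => (T.branch r w).card)
      (fun w hw => Adj.one_le_card_branch (by simpa using hw)) hr hs.le
    have h3 : ∑ w with T.Adj r w, (T.branch r w).card = Fintype.card V - 1 := by lia
    have h4 := (Finset.card_le_univ (Finset.univ.filter (T.Adj r)))
    rw [h3, sinRatio_pred hθ (by lia)] at h2
    rwa [hzr, mul_one, h1]
  refine ⟨z, hpos, fun u => ?_, hroot⟩
  rcases eq_or_ne u r with rfl | hur
  · exact hroot.le
  have hp := hadj u hur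
  have hmem : par u ∈ Finset.univ.filter (T.Adj u) := by simp [hp]
  have h1 : ∑ w ∈ (Finset.univ.filter (T.Adj u)).erase (par u), z w =
      z u * ∑ w ∈ (Finset.univ.filter (T.Adj u)).erase (par u),
        sinRatio θ (T.branch u w).card := by
    rw [Finset.mul_sum]
    refine Finset.sum_congr rfl fun w hw => ?_
    simp only [Finset.mem_erase, Finset.mem_filter, Finset.mem_univ, true_and] at hw
    rw [hchild u w hw.2, mul_comm]
    refine (hT.dist_eq_dist_add_one_of_adj r hw.2).resolve_left fun h => hw.1 ?_
    exact hT.eq_of_adj_of_dist_eq_add_one hw.2 hp h (hdist u hur)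
  have h2 := hT.sum_card_branch_erase hp.symm
  have h3 := hcard hp.symm
  have h4 := sinRatio_sum_le hθ ((Finset.univ.filter (T.Adj u)).erase (par u))
    (fun w => (T.branch u w).card) (by lia)
  rw [← Finset.add_sum_erase _ _ hmem, h1]
  have h5 := sinRatio_recurrence hθ (k := ∑ w ∈ (Finset.univ.filter (T.Adj u)).erase (par u),
    (T.branch u w).card) (by lia)
  rw [h2] at h5
  have h6 := mul_le_mul_of_nonneg_left h4 (hpos u).le
  have h7 := hz u hur
  calc 2 * Real.cos θ * z u
      = (2 * Real.cos θ * sinRatio θ (T.branch (par u) u).card) * z (par u) := by rw [h7]; ring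
    _ = z (par u) + z u * sinRatio θ (∑ w ∈ (Finset.univ.filter (T.Adj u)).erase (par u),
          (T.branch u w).card) := by rw [h5, h7]; ring
    _ ≤ _ := by linarith

/-! ### Trees of maximum degree at most 2 are paths. -/

open Classical in
theorem IsTree.nonempty_iso_pathGraph (hT : T.IsTree) {n : ℕ} (hV : Fintype.card V = n)
    (hn : 2 ≤ n) (h : ∀ u, (Finset.univ.filter (T.Adj u)).card ≤ 2) :
    Nonempty (T ≃g pathGraph n) := by
  have : Nontrivial V := Fintype.one_lt_card_iff_nontrivial.1 (by lia)
  obtain ⟨r, hr⟩ := hT.exists_vert_degree_one_of_nontrivial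
  have hr' : (Finset.univ.filter (T.Adj r)).card = 1 := by
    rw [← hr, ← card_neighborFinset_eq_degree]
    congr 1
    ext; simp
  -- Seen from a leaf, every distance level is a single vertex: two children and a parent would make
  -- degree 3.
  have hinj : ∀ m u v, T.dist r u = m → T.dist r v = m → u = v := by
    intro m
    induction m with
    | zero =>
      intro u v hu hv
      rw [hT.connected.dist_eq_zero_iff] at hu hv
      rw [← hu, hv]
    | succ m ih =>
      intro u v hu hv
      have hur : u ≠ r := by rintro rfl; simp at hu
      have hvr : v ≠ r := by rintro rfl; simp at hv
      obtain ⟨p, hp, hdp⟩ := hT.connected.exists_adj_dist_eq_add_one hur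
      obtain ⟨q, hq, hdq⟩ := hT.connected.exists_adj_dist_eq_add_one hvr
      obtain rfl : p = q := ih p q (by lia) (by lia)
      by_contra huv
      rcases eq_or_ne p r with rfl | hpr
      · refine huv (Finset.card_le_one.1 hr'.le u ?_ v ?_) <;> simp [hp.symm, hq.symm]
      · obtain ⟨s, hs, hds⟩ := hT.connected.exists_adj_dist_eq_add_one hpr
        have hsub : ({u, v, s} : Finset V) ⊆ Finset.univ.filter (T.Adj p) := by
          intro x hx
          simp only [Finset.mem_insert, Finset.mem_singleton] at hx
          rcases hx with rfl | rfl | rfl <;> simp [hp.symm, hq.symm, hs]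
        have h3 : ({u, v, s} : Finset V).card = 3 := by
          rw [Finset.card_eq_three]
          refine ⟨u, v, s, huv, ?_, ?_, rfl⟩
          · rintro rfl; lia
          · rintro rfl; lia
        have := Finset.card_le_card hsub
        have := h p
        lia
  have hlt : ∀ u, T.dist r u < n := fun u => by
    obtain ⟨p, hp, hl⟩ := hT.connected.exists_path_of_dist r u
    rw [← hl, ← hV]
    exact hp.length_lt
  let f : V → Fin n := fun u => ⟨T.dist r u, hlt u⟩
  have hf : Function.Bijective f := by
    rw [Fintype.bijective_iff_injective_and_card]
    exact ⟨fun u v huv => hinj _ u v rfl (by simpa [f, eq_comm] using huv), by simp [hV]⟩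
  have hstep : ∀ u v, T.dist r v = T.dist r u + 1 → T.Adj u v := by
    intro u v hd
    obtain ⟨p, hp, hdp⟩ :=
      hT.connected.exists_adj_dist_eq_add_one (r := r) (u := v) (by rintro rfl; simp at hd)
    obtain rfl : p = u := hinj _ p u rfl (by lia)
    exact hp.symm
  refine ⟨⟨Equiv.ofBijective f hf, fun {u v} => ?_⟩⟩
  simp only [Equiv.ofBijective_apply, pathGraph_adj, f]
  constructor
  · rintro (h | h)
    · exact hstep u v h.symm
    · exact (hstep v u h.symm).symm
  · intro h
    have := hT.dist_eq_dist_add_one_of_adj r h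
    lia

end SimpleGraph

/-! ### Spectral bounds from test vectors. -/

theorem Matrix.IsHermitian.exists_mem_spectrum_lt {ι : Type*} [Fintype ι] [DecidableEq ι]
    {M : Matrix ι ι ℝ} (hM : M.IsHermitian) {b : ℝ} (x : ι → ℝ)
    (hx : x ⬝ᵥ M.mulVec x < b * (x ⬝ᵥ x)) : ∃ μ ∈ spectrum ℝ M, μ < b := by
  by_contra! h
  have hpsd : (algebraMap ℝ (Matrix ι ι ℝ) (-b) + M).PosSemidef := by
    rw [Matrix.posSemidef_iff_isHermitian_and_spectrum_nonneg]
    refine ⟨Matrix.IsHermitian.add ?_ hM, ?_⟩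
    · rw [Matrix.algebraMap_eq_diagonal]
      exact Matrix.isHermitian_diagonal _
    · rw [← spectrum.singleton_add_eq]
      rintro _ ⟨_, rfl, μ, hμ, rfl⟩
      have := h μ hμ
      simpa using this
  have := (Matrix.posSemidef_iff_dotProduct_mulVec.1 hpsd).2 x
  rw [Matrix.add_mulVec, Algebra.algebraMap_eq_smul_one, Matrix.smul_mulVec, Matrix.one_mulVec,
    star_trivial, dotProduct_add, dotProduct_smul, smul_eq_mul] at this
  linarith

/-- Collatz–Wielandt argument: evaluate the eigenvector equation where |y i| / x i is largest. -/
theorem Matrix.abs_le_of_mem_spectrum {ι : Type*} [Fintype ι] [DecidableEq ι]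
    {M : Matrix ι ι ℝ} {c : ℝ} {x : ι → ℝ} (hx : ∀ i, 0 < x i)
    (h : ∀ i, ∑ j, |M i j| * x j ≤ c * x i) {μ : ℝ} (hμ : μ ∈ spectrum ℝ M) : |μ| ≤ c := by
  rw [← Matrix.spectrum_toLin', ← Module.End.hasEigenvalue_iff_mem_spectrum] at hμ
  obtain ⟨y, hy, hy0⟩ := hμ.exists_hasEigenvector
  rw [Module.End.mem_eigenspace_iff, Matrix.toLin'_apply] at hy
  obtain ⟨k, hk⟩ := Function.ne_iff.1 hy0
  obtain ⟨i, -, hi⟩ := Finset.exists_max_image Finset.univ (fun i => |y i| / x i) ⟨k, by simp⟩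
  set s := |y i| / x i with hs
  have hle : ∀ j, |y j| ≤ s * x j := fun j => (div_le_iff₀ (hx j)).1 (hi j (Finset.mem_univ j))
  have hs0 : 0 < s := lt_of_lt_of_le (div_pos (abs_pos.2 hk) (hx k)) (hi k (Finset.mem_univ k))
  have hyi : |y i| = s * x i := by rw [hs, div_mul_cancel₀ _ (hx i).ne']
  have h1 : |μ| * (s * x i) ≤ c * (s * x i) := by
    calc |μ| * (s * x i) = |∑ j, M i j * y j| := by
          rw [← hyi, ← abs_mul]
          exact congrArg abs (congrFun hy i).symm
      _ ≤ ∑ j, |M i j| * |y j| := by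
          refine (Finset.abs_sum_le_sum_abs _ _).trans_eq ?_
          simp only [abs_mul]
      _ ≤ ∑ j, s * (|M i j| * x j) := by
          refine Finset.sum_le_sum fun j _ => ?_
          rw [mul_left_comm]
          exact mul_le_mul_of_nonneg_left (hle j) (abs_nonneg _)
      _ ≤ s * (c * x i) := by
          rw [← Finset.mul_sum]
          exact mul_le_mul_of_nonneg_left (h i) hs0.le
      _ = c * (s * x i) := by ring
  exact le_of_mul_le_mul_right h1 (mul_pos hs0 (hx i))

/-! ### Invariance under graph isomorphism. -/

section Iso

namespace SimpleGraph

variable {V W : Type*} {G : SimpleGraph V} {H : SimpleGraph W}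

theorem Hom.edist_le (f : G →g H) (u v : V) : H.edist (f u) (f v) ≤ G.edist u v :=
  le_iInf fun w => (SimpleGraph.edist_le (w.map f)).trans (by simp)

theorem Iso.edist_eq (f : G ≃g H) (u v : V) : H.edist (f u) (f v) = G.edist u v :=
  (f.toHom.edist_le u v).antisymm (by simpa using f.symm.toHom.edist_le (f u) (f v))

theorem Iso.eccent_eq (f : G ≃g H) (u : V) : H.eccent (f u) = G.eccent u := by
  simp only [eccent_def, ← f.edist_eq]
  exact (f.toEquiv.iSup_comp (g := fun w => H.edist (f u) w)).symm

theorem Iso.eccentricityMatrix_eq (f : G ≃g H) (u v : V) :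
    eccentricityMatrix H (f u) (f v) = eccentricityMatrix G u v := by
  simp only [eccentricityMatrix, Matrix.of_apply, SimpleGraph.dist, f.edist_eq, f.eccent_eq]

theorem Iso.leastEccEigenvalue_eq [Fintype V] [DecidableEq V] [Fintype W] [DecidableEq W]
    (f : G ≃g H) : leastEccEigenvalue G = leastEccEigenvalue H := by
  have : Matrix.reindexAlgEquiv ℝ ℝ f.toEquiv.symm (eccentricityMatrix H) =
      eccentricityMatrix G := by
    ext u v
    exact f.eccentricityMatrix_eq u v
  rw [leastEccEigenvalue, leastEccEigenvalue, ← this, AlgEquiv.spectrum_eq]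

end SimpleGraph

end Iso

/-! ### The eccentricity matrix of a complement. -/

namespace SimpleGraph

variable {V : Type*} {T : SimpleGraph V}

theorem eccentricityMatrix_nonneg (G : SimpleGraph V) (u v : V) :
    0 ≤ eccentricityMatrix G u v := by
  rw [eccentricityMatrix, Matrix.of_apply]
  split_ifs <;> positivity

theorem eccentricityMatrix_le_dist (G : SimpleGraph V) (u v : V) :
    eccentricityMatrix G u v ≤ G.dist u v := by
  rw [eccentricityMatrix, Matrix.of_apply]
  split_ifs
  · exact le_rfl
  · positivity

/-- Off the diagonal such a pair has distance 1 in the complement, while a T-neighbour forces every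
eccentricity above 1. -/
theorem eccentricityMatrix_compl_eq_zero (hT : ∀ u, ∃ w, T.Adj u w) {u v : V}
    (h : ¬ T.Adj u v) : eccentricityMatrix Tᶜ u v = 0 := by
  rcases eq_or_ne u v with rfl | huv
  · simp [eccentricityMatrix]
  have h1 : Tᶜ.edist u v = 1 := by simp [huv, h]
  have h2 : ∀ u, 1 < Tᶜ.eccent u := fun u => by
    obtain ⟨w, hw⟩ := hT u
    refine lt_of_lt_of_le ?_ (edist_le_eccent (v := w))
    rw [← not_le, edist_le_one_iff_adj_or_eq]
    simp [hw, hw.ne]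
  rw [eccentricityMatrix, Matrix.of_apply, if_neg]
  rw [h1]
  exact (lt_min (h2 u) (h2 v)).ne

theorem two_lt_edist_compl_iff {u v : V} :
    2 < Tᶜ.edist u v ↔ T.Adj u v ∧ ∀ w, w ≠ u → w ≠ v → T.Adj u w ∨ T.Adj v w := by
  rw [two_lt_edist_iff, Set.eq_empty_iff_forall_notMem]
  simp only [mem_commonNeighbors, compl_adj]
  constructor
  · rintro ⟨h1, h2, h3⟩
    refine ⟨by tauto, fun w hu hv => ?_⟩
    have := h3 w
    have := hu.symm
    have := hv.symm
    tauto
  · rintro ⟨h1, h2⟩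
    refine ⟨h1.ne, by tauto, fun w hw => ?_⟩
    have := h2 w (Ne.symm hw.1.1) (Ne.symm hw.2.1)
    tauto

/-- Otherwise u and v both have vertices, w and w', farther away than each other. Each is then a
T-neighbour, and u, v, w', w form a cycle in T. The entry can be 3, at the central edge of a double
star. -/
theorem IsTree.two_le_eccentricityMatrix_compl (hT : T.IsTree) (hTc : Tᶜ.Connected) {u v : V}
    (h : T.Adj u v) : 2 ≤ eccentricityMatrix Tᶜ u v := by
  have h2 : 2 ≤ Tᶜ.dist u v := hTc.one_lt_dist_of_ne_of_not_adj h.ne (by simp [h])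
  have h2' : (2 : ℕ∞) ≤ Tᶜ.edist u v := by
    rw [← (hTc u v).coe_dist_eq_edist]
    exact_mod_cast h2
  rw [eccentricityMatrix, Matrix.of_apply, if_pos]
  · exact_mod_cast h2
  by_contra hne
  have hlt := lt_of_le_of_ne (le_min edist_le_eccent
    ((edist_comm (G := Tᶜ) (u := u) (v := v)).le.trans edist_le_eccent)) hne
  rw [lt_min_iff] at hlt
  have hfar : ∀ x, Tᶜ.edist u v < Tᶜ.eccent x → ∃ w, Tᶜ.edist u v < Tᶜ.edist x w :=
    fun x hx => lt_iSup_iff.1 hx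
  obtain ⟨w, hw⟩ := hfar u hlt.1
  obtain ⟨w', hw'⟩ := hfar v hlt.2
  have hwv : w ≠ v := by rintro rfl; exact lt_irrefl _ hw
  have hwu : w' ≠ u := by rintro rfl; rw [edist_comm] at hw'; exact lt_irrefl _ hw'
  obtain ⟨huw, hdom⟩ := two_lt_edist_compl_iff.1 (h2'.trans_lt hw)
  obtain ⟨hvw, -⟩ := two_lt_edist_compl_iff.1 (h2'.trans_lt hw')
  have huw' : ¬ T.Adj u w' := fun hadj => by
    have := hT.dist_ne_of_adj u hvw
    rw [dist_eq_one_iff_adj.2 h, dist_eq_one_iff_adj.2 hadj] at this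
    exact this rfl
  have hww' : w' ≠ w := by rintro rfl; exact huw' huw
  have hadj := (hdom w' hwu hww').resolve_left huw'
  have hd := hT.dist_eq_dist_add_one_of_adj u hadj
  have hpos := hT.connected.dist_eq_zero_iff (u := u) (v := w')
  have hd1 := dist_eq_one_iff_adj.2 huw
  have hd2 := dist_eq_one_iff_adj.2 h
  have hd3 : T.dist u w' = 2 := by
    have : T.dist u w' ≠ 0 := fun h0 => hwu (hpos.1 h0).symm
    lia
  exact hwv (hT.eq_of_adj_of_dist_eq_add_one (r := u) hadj.symm hvw.symm (by lia) (by lia))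

variable [Fintype V]

open Classical in
theorem IsTree.leastEccEigenvalue_compl_lt [DecidableEq V] (hT : T.IsTree) (hTc : Tᶜ.Connected)
    {θ : ℝ} (hθ : ((Fintype.card V : ℝ) + 1) * θ = Real.pi) {r : V}
    (hr : 3 ≤ (Finset.univ.filter (T.Adj r)).card) :
    leastEccEigenvalue Tᶜ < -(4 * Real.cos θ) := by
  obtain ⟨z, hz, hle, hlt⟩ := hT.exists_pos_two_cos_mul_le_sum hθ hr
  have : Nonempty V := ⟨r⟩
  have hnbr : ∀ u, ∃ w, T.Adj u w := by
    have : Nontrivial V := Fintype.one_lt_card_iff_nontrivial.1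
      (lt_of_lt_of_le (by lia) (Finset.card_le_univ (Finset.univ.filter (T.Adj r))))
    intro u
    obtain ⟨v, hv⟩ := exists_ne u
    obtain ⟨w, hw, -⟩ := hT.connected.exists_adj_dist_eq_add_one hv.symm
    exact ⟨w, hw⟩
  -- The sign is the bipartition of T, so every edge contributes negatively.
  let y : V → ℝ := fun u => (-1) ^ T.dist r u * z u
  have hentry : ∀ u v, y u * (eccentricityMatrix Tᶜ u v * y v) ≤
      if T.Adj u v then -2 * (z u * z v) else 0 := by
    intro u v
    split_ifs with h
    · have hsign : ((-1 : ℝ) ^ T.dist r u) * (-1) ^ T.dist r v = -1 := by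
        rw [← pow_add]
        apply Odd.neg_one_pow
        have := hT.dist_eq_dist_add_one_of_adj r h
        rw [Nat.odd_iff]
        lia
      have h2 := hT.two_le_eccentricityMatrix_compl hTc h
      have h3 := mul_pos (hz u) (hz v)
      calc y u * (eccentricityMatrix Tᶜ u v * y v)
          = (((-1 : ℝ) ^ T.dist r u) * (-1) ^ T.dist r v) *
              (eccentricityMatrix Tᶜ u v * (z u * z v)) := by simp only [y]; ring
        _ ≤ -2 * (z u * z v) := by
          rw [hsign]
          linarith [mul_le_mul_of_nonneg_right h2 h3.le]
    · rw [eccentricityMatrix_compl_eq_zero hnbr h]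
      simp
  have hyy : y ⬝ᵥ y = ∑ u, z u * z u := by
    refine Finset.sum_congr rfl fun u _ => ?_
    have : ((-1 : ℝ) ^ T.dist r u) * (-1) ^ T.dist r u = 1 := by
      rw [← mul_pow]; simp
    linear_combination (z u * z u) * this
  have hquad : y ⬝ᵥ (eccentricityMatrix Tᶜ).mulVec y < -(4 * Real.cos θ) * (y ⬝ᵥ y) := by
    rw [hyy, Finset.mul_sum]
    refine lt_of_le_of_lt (b := ∑ u, -2 * z u * ∑ w with T.Adj u w, z w) ?_ ?_
    · refine Finset.sum_le_sum fun u _ => ?_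
      rw [Matrix.mulVec, dotProduct, Finset.mul_sum, Finset.mul_sum, Finset.sum_filter]
      refine Finset.sum_le_sum fun v _ => (hentry u v).trans_eq ?_
      split_ifs <;> ring
    · refine Finset.sum_lt_sum (fun u _ => ?_) ⟨r, Finset.mem_univ r, ?_⟩
      · linarith [mul_le_mul_of_nonneg_left (hle u) (hz u).le]
      · linarith [mul_lt_mul_of_pos_left hlt (hz r)]
  obtain ⟨μ, hμ, hlt'⟩ :=
    (eccentricityMatrix_isHermitian Tᶜ).exists_mem_spectrum_lt y hquad
  exact ((isLeast_leastEccEigenvalue Tᶜ).2 hμ).trans_lt hlt'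

/-! ### The complement of the path. -/

theorem dist_compl_pathGraph_le_two {n : ℕ} (hn : 5 ≤ n) {i j : Fin n}
    (h : (pathGraph n).Adj i j) : (pathGraph n)ᶜ.dist i j ≤ 2 := by
  suffices ∃ k, (pathGraph n)ᶜ.Adj i k ∧ (pathGraph n)ᶜ.Adj k j by
    obtain ⟨k, h1, h2⟩ := this
    exact dist_le (Walk.cons h1 (Walk.cons h2 Walk.nil))
  simp only [compl_adj, pathGraph_adj, ne_eq, Fin.ext_iff] at h ⊢
  have hi := i.isLt
  have hj := j.isLt
  -- The common non-neighbour is 4 for the edge {1, 2}, 3 for {0, 1}, and 0 for all others.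
  by_cases h3 : 2 ≤ (i : ℕ) ∧ 2 ≤ (j : ℕ)
  · exact ⟨⟨0, by lia⟩, by simp only; lia, by simp only; lia⟩
  · by_cases h4 : (i : ℕ) ≤ 2 ∧ (j : ℕ) ≤ 2 ∧ ((i : ℕ) = 2 ∨ (j : ℕ) = 2)
    · exact ⟨⟨4, by lia⟩, by simp only; lia, by simp only; lia⟩
    · exact ⟨⟨3, by lia⟩, by simp only; lia, by simp only; lia⟩

theorem sum_pathGraph_adj_sin_le {n : ℕ} {θ : ℝ} (hθ : (n + 1) * θ = Real.pi) (i : Fin n) :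
    ∑ j : Fin n with i.val + 1 = j.val ∨ j.val + 1 = i.val, Real.sin ((j.val + 1 : ℕ) * θ) ≤
      2 * Real.cos θ * Real.sin ((i.val + 1 : ℕ) * θ) := by
  -- Each side has at most one neighbour; a missing one corresponds to k = 0 or k = n+1, where the
  -- sine is 0.
  have hsingle : ∀ (s : Finset (Fin n)) (k : ℕ), k ≤ n + 1 → (∀ j ∈ s, j.val + 1 = k) →
      ∑ j ∈ s, Real.sin ((j.val + 1 : ℕ) * θ) ≤ Real.sin (k * θ) := by
    intro s k hk hs
    have hc : s.card ≤ 1 := Finset.card_le_one.2 fun a ha b hb => by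
      have := hs a ha
      have := hs b hb
      exact Fin.ext (by lia)
    rw [Finset.sum_congr rfl fun j hj => by rw [hs j hj], Finset.sum_const, nsmul_eq_mul]
    exact mul_le_of_le_one_left (sin_natCast_mul_nonneg hθ hk) (by exact_mod_cast hc)
  rw [Finset.filter_or, Finset.sum_union (by
    rw [Finset.disjoint_filter]
    intro j _ h1 h2
    lia)]
  have h1 := hsingle {j | i.val + 1 = j.val} (i.val + 2) (by lia) fun j hj => by
    simp only [Finset.mem_filter, Finset.mem_univ, true_and] at hj
    lia
  have h2 := hsingle {j | j.val + 1 = i.val} i.val (by lia) fun j hj => by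
    simpa using hj
  refine (add_le_add h1 h2).trans_eq ?_
  push_cast
  have a : ((i : ℝ) + 2) * θ = (i + 1) * θ + θ := by ring
  have b : (i : ℝ) * θ = (i + 1) * θ - θ := by ring
  rw [a, b, Real.sin_add, Real.sin_sub]
  ring

theorem neg_four_mul_cos_le_leastEccEigenvalue_compl_pathGraph {n : ℕ} (hn : 5 ≤ n) {θ : ℝ}
    (hθ : (n + 1) * θ = Real.pi) :
    -(4 * Real.cos θ) ≤ leastEccEigenvalue (pathGraph n)ᶜ := by
  have : NeZero n := ⟨by lia⟩
  have hmem := (isLeast_leastEccEigenvalue (pathGraph n)ᶜ).1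
  have hnbr : ∀ i : Fin n, ∃ j, (pathGraph n).Adj i j := fun i => by
    simp only [pathGraph_adj]
    have := i.isLt
    rcases Nat.eq_zero_or_pos i with h | h
    · exact ⟨⟨1, by lia⟩, by simp only; lia⟩
    · exact ⟨⟨i - 1, by lia⟩, by simp only; lia⟩
  refine (abs_le.1 (Matrix.abs_le_of_mem_spectrum
    (x := fun j : Fin n => Real.sin ((j.val + 1 : ℕ) * θ))
    (fun j => sin_natCast_mul_pos hθ (by lia) (by lia)) (fun i => ?_) hmem)).1
  have hle : ∑ j, |eccentricityMatrix (pathGraph n)ᶜ i j| * Real.sin ((j.val + 1 : ℕ) * θ) ≤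
      2 * ∑ j : Fin n with i.val + 1 = j.val ∨ j.val + 1 = i.val,
        Real.sin ((j.val + 1 : ℕ) * θ) := by
    rw [Finset.sum_filter, Finset.mul_sum]
    refine Finset.sum_le_sum fun j _ => ?_
    rw [abs_of_nonneg (eccentricityMatrix_nonneg _ i j)]
    split_ifs with h
    · refine mul_le_mul_of_nonneg_right ?_ (sin_natCast_mul_pos hθ (by lia) (by lia)).le
      refine (eccentricityMatrix_le_dist _ i j).trans ?_
      exact_mod_cast dist_compl_pathGraph_le_two hn (pathGraph_adj.2 h)
    · rw [eccentricityMatrix_compl_eq_zero hnbr (by rwa [pathGraph_adj])]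
      simp
  refine hle.trans ?_
  linarith [sum_pathGraph_adj_sin_le hθ i]

end SimpleGraph

theorem mainTheorem5 {V : Type*} [Fintype V] [DecidableEq V] (n : ℕ) (hn : 4 ≤ n)
    (hV : Fintype.card V = n) (T : SimpleGraph V) (hT : T.IsTree) (hTc : Tᶜ.Connected) :
    leastEccEigenvalue Tᶜ ≤ leastEccEigenvalue (SimpleGraph.pathGraph n)ᶜ ∧
      (leastEccEigenvalue Tᶜ = leastEccEigenvalue (SimpleGraph.pathGraph n)ᶜ ↔
        Nonempty (T ≃g SimpleGraph.pathGraph n)) := by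
  classical
  have hiso : Nonempty (T ≃g SimpleGraph.pathGraph n) →
      leastEccEigenvalue Tᶜ = leastEccEigenvalue (SimpleGraph.pathGraph n)ᶜ := by
    rintro ⟨f⟩
    refine SimpleGraph.Iso.leastEccEigenvalue_eq ⟨f.toEquiv, fun {u v} => ?_⟩
    have := f.map_adj_iff (v := u) (w := v)
    simp only [SimpleGraph.compl_adj]
    simp_all
  by_cases hpath : Nonempty (T ≃g SimpleGraph.pathGraph n)
  · exact ⟨(hiso hpath).le, fun _ => hpath, hiso⟩
  suffices h : leastEccEigenvalue Tᶜ < leastEccEigenvalue (SimpleGraph.pathGraph n)ᶜ from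
    ⟨h.le, fun h' => absurd h' h.ne, hiso⟩
  obtain ⟨r, hr⟩ : ∃ r, 3 ≤ (Finset.univ.filter (T.Adj r)).card := by
    by_contra! h
    exact hpath (hT.nonempty_iso_pathGraph hV (by lia) fun u => Nat.le_of_lt_succ (h u))
  -- Counted are r, three neighbours, and a non-neighbour supplied by connectedness of the
  -- complement.
  have hn5 : 5 ≤ n := by
    have : Nontrivial V := Fintype.one_lt_card_iff_nontrivial.1 (by lia)
    obtain ⟨v, hv⟩ := exists_ne r
    obtain ⟨s, hs, -⟩ := hTc.exists_adj_dist_eq_add_one hv.symm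
    rw [SimpleGraph.compl_adj] at hs
    have hr' : r ∉ insert s (Finset.univ.filter (T.Adj r)) := by simp [hs.1]
    have hs' : s ∉ Finset.univ.filter (T.Adj r) := by simp [hs.2]
    have := Finset.card_le_univ (insert r (insert s (Finset.univ.filter (T.Adj r))))
    rw [Finset.card_insert_of_notMem hr', Finset.card_insert_of_notMem hs'] at this
    lia
  have hθ : ((n : ℝ) + 1) * (Real.pi / (n + 1)) = Real.pi := by field_simp
  exact (hT.leastEccEigenvalue_compl_lt hTc (by rw [hV]; exact hθ) hr).trans_le
    (SimpleGraph.neg_four_mul_cos_le_leastEccEigenvalue_compl_pathGraph hn5 hθ)
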